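/- Let $\mathbb{F}$ be a field. For a Lie algebra $L$ over $\mathbb{F}$ put $L^2=[L,L]$. Let $L\otimes L$ be the nonabelian tensor square, i.e. the Lie algebra over $\mathbb F$ generated by symbols $l\otimes k$ $(l,k\in L)$ subject to the relations \[c(l\otimes k)=cl\otimes k=l\otimes ck,\quad (l+l')\otimes k=l\otimes k+l'\otimes k,\quad l\otimes(k+k')=l\otimes k+l\otimes k',\] \[[l,l']\otimes k=l\otimes[l',k]-l'\otimes[l,k],\quad l\otimes[k,k']=[k',l]\otimes k-[k,l]\otimes k',\quad [l\otimes k,l'\otimes k']=-[k,l]\otimes[l',k'],\] for $c\in\mathbb F$ and $l,l',k,k'\in L$, and let the diagonal ideal $L\square L$ be the ideal of $L\otimes L$ generated by the elements $l\otimes l$, $l\in L$. Let $A(n)$ be the abelian Lie algebra of dimension $n$, and $H(m)$ the Heisenberg Lie algebra with basis $x_1,\dots,x_{2m},x$ and nonzero brackets $[x_{2i-1},x_{2i}]=x$ $(1\le i\le m)$. Let $L_{4,3}$ have basis $x_1,\dots,x_4$ with $[x_1,x_2]=x_3$, $[x_1,x_3]=x_4$. Let $L_{5,1}=A(5)$,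 $L_{5,2}=H(1)\oplus A(2)$, $L_{5,3}=L_{4,3}\oplus A(1)$, $L_{5,4}=H(2)$, and let $L_{5,5},\dots,L_{5,9}$ have basis $x_1,\dots,x_5$ and the following brackets, where here and above brackets of basis vectors that do not follow from the listed ones by antisymmetry are zero: - $L_{5,5}$: $[x_1,x_2]=x_3$, $[x_1,x_3]=[x_2,x_4]=x_5$; - $L_{5,6}$: $[x_1,x_2]=x_3$, $[x_1,x_3]=x_4$, $[x_1,x_4]=[x_2,x_3]=x_5$; - $L_{5,7}$: $[x_1,x_2]=x_3$, $[x_1,x_3]=x_4$, $[x_1,x_4]=x_5$; - $L_{5,8}$: $[x_1,x_2]=x_4$, $[x_1,x_3]=x_5$; - $L_{5,9}$: $[x_1,x_2]=x_3$, $[x_1,x_3]=x_4$, $[x_2,x_3]=x_5$. Then \[L_{5,k}\,\square\, L_{5,k}\cong\begin{cases}A(3)&\text{if }k=6,7,9,\\ A(6)&\text{if }k=3,5,8,\\ A(10)&\text{if }k=2,4,\\ A(15)&\text{if }k=1.\end{cases}\] Moreover, for every nilpotent Lie algebra $L$ over $\mathbb F$ of finite dimension $n$ with $\dim L^2=m$,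 there is an isomorphism of Lie algebras $L\square L\cong (L/L^2)\square(L/L^2)$, and $\dim\big((L/L^2)\square(L/L^2)\big)=\tfrac12(n-m)(n-m+1)$. -/

import Mathlib

namespace LieSquare

/-! ### Lie algebras given by a table of brackets of basis vectors -/

/-- The alternating bilinear bracket on `F ^ n` determined by a list of relations: an entry
`(i, j, k)` stands for `[x_i, x_j] = x_k = -[x_j, x_i]`, and brackets of basis vectors which
are not listed vanish. (No pair `i, j` is listed twice in the tables below.) -/
def tableBracket {F : Type*} [Field F] {n : ℕ} (rels : List (Fin n × Fin n × Fin n))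
    (x y : Fin n → F) : Fin n → F :=
  (rels.map fun r => Pi.single r.2.2 (x r.1 * y r.2.1 - x r.2.1 * y r.1)).sum

/-- A list of relations whose bracket satisfies the Jacobi identity over `F`. -/
structure BracketTable (F : Type*) [Field F] (n : ℕ) where
  rels : List (Fin n × Fin n × Fin n)
  jacobi : ∀ x y z : Fin n → F,
    tableBracket rels x (tableBracket rels y z) =
      tableBracket rels (tableBracket rels x y) z + tableBracket rels y (tableBracket rels x z)

theorem tableBracket_nil {F : Type*} [Field F] {n : ℕ} (x y : Fin n → F) :
    tableBracket [] x y = 0 := rfl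

theorem tableBracket_cons {F : Type*} [Field F] {n : ℕ} (r : Fin n × Fin n × Fin n)
    (rels : List (Fin n × Fin n × Fin n)) (x y : Fin n → F) :
    tableBracket (r :: rels) x y =
      Pi.single r.2.2 (x r.1 * y r.2.1 - x r.2.1 * y r.1) + tableBracket rels x y := by
  simp [tableBracket]

theorem tableBracket_add_left {F : Type*} [Field F] {n : ℕ}
    (rels : List (Fin n × Fin n × Fin n)) (x x' y : Fin n → F) :
    tableBracket rels (x + x') y = tableBracket rels x y + tableBracket rels x' y := by
  induction rels with
  | nil => simp [tableBracket_nil]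
  | cons r rels ih =>
    rw [tableBracket_cons, tableBracket_cons, tableBracket_cons, ih, add_add_add_comm,
      ← Pi.single_add]
    congr 2
    simp only [Pi.add_apply]
    ring

theorem tableBracket_swap {F : Type*} [Field F] {n : ℕ}
    (rels : List (Fin n × Fin n × Fin n)) (x y : Fin n → F) :
    tableBracket rels x y = -tableBracket rels y x := by
  induction rels with
  | nil => simp [tableBracket_nil]
  | cons r rels ih =>
    rw [tableBracket_cons, tableBracket_cons, ih, neg_add, ← Pi.single_neg]
    congr 2
    ring

theorem tableBracket_add_right {F : Type*} [Field F] {n : ℕ}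
    (rels : List (Fin n × Fin n × Fin n)) (x y z : Fin n → F) :
    tableBracket rels x (y + z) = tableBracket rels x y + tableBracket rels x z := by
  rw [tableBracket_swap, tableBracket_add_left, neg_add, ← tableBracket_swap,
    ← tableBracket_swap]

theorem tableBracket_self {F : Type*} [Field F] {n : ℕ}
    (rels : List (Fin n × Fin n × Fin n)) (x : Fin n → F) : tableBracket rels x x = 0 := by
  induction rels with
  | nil => rfl
  | cons r rels ih => rw [tableBracket_cons, ih, mul_comm, sub_self, Pi.single_zero, add_zero]

theorem tableBracket_smul_right {F : Type*} [Field F] {n : ℕ}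
    (rels : List (Fin n × Fin n × Fin n)) (c : F) (x y : Fin n → F) :
    tableBracket rels x (c • y) = c • tableBracket rels x y := by
  induction rels with
  | nil => simp [tableBracket_nil]
  | cons r rels ih =>
    rw [tableBracket_cons, tableBracket_cons, ih, smul_add, ← Pi.single_smul]
    congr 2
    simp only [Pi.smul_apply, smul_eq_mul]
    ring

/-- The Lie algebra with basis `x_0, …, x_(n-1)` and the brackets listed in the table. -/
def BracketTable.Alg {F : Type*} [Field F] {n : ℕ} (_T : BracketTable F n) :
    Type _ := Fin n → F

instance {F : Type*} [Field F] {n : ℕ} (T : BracketTable F n) : AddCommGroup T.Alg :=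
  inferInstanceAs (AddCommGroup (Fin n → F))

instance {F : Type*} [Field F] {n : ℕ} (T : BracketTable F n) : Module F T.Alg :=
  inferInstanceAs (Module F (Fin n → F))

instance {F : Type*} [Field F] {n : ℕ} (T : BracketTable F n) : LieRing T.Alg where
  bracket x y := tableBracket T.rels x y
  add_lie x y z := tableBracket_add_left T.rels x y z
  lie_add x y z := tableBracket_add_right T.rels x y z
  lie_self x := tableBracket_self T.rels x
  leibniz_lie x y z := T.jacobi x y z

instance {F : Type*} [Field F] {n : ℕ} (T : BracketTable F n) : LieAlgebra F T.Alg where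
  lie_smul c x y := tableBracket_smul_right T.rels c x y

/-- `A(n)`, the abelian Lie algebra of dimension `n`. -/
abbrev A (F : Type*) [Field F] (n : ℕ) : Type _ :=
  BracketTable.Alg (F := F) (n := n) ⟨[], fun _ _ _ => by simp [tableBracket_nil]⟩

/-- The nonzero brackets `[x_(2i), x_(2i+1)] = x_(2m)`, `0 ≤ i < m`, of the Heisenberg algebra. -/
def heisenbergRels (m : ℕ) : List (Fin (2 * m + 1) × Fin (2 * m + 1) × Fin (2 * m + 1)) :=
  (List.finRange m).map fun i =>
    (⟨2 * i.1, by omega⟩, ⟨2 * i.1 + 1, by omega⟩, Fin.last (2 * m))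

theorem heisenberg_bracket_bracket {F : Type*} [Field F] (m : ℕ) (x y z : Fin (2 * m + 1) → F) :
    tableBracket (heisenbergRels m) x (tableBracket (heisenbergRels m) y z) = 0 := by
  have key : ∀ j : Fin (2 * m + 1), j ≠ Fin.last (2 * m) →
      tableBracket (heisenbergRels m) y z j = 0 := by
    intro j hj
    have : ∀ l : List (Fin m), tableBracket (l.map fun i =>
        ((⟨2 * i.1, by omega⟩, ⟨2 * i.1 + 1, by omega⟩, Fin.last (2 * m)) :
          Fin (2 * m + 1) × Fin (2 * m + 1) × Fin (2 * m + 1))) y z j = 0 := by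
      intro l
      induction l with
      | nil => rfl
      | cons i l ih =>
        rw [List.map_cons, tableBracket_cons, Pi.add_apply, ih, Pi.single_eq_of_ne hj, add_zero]
    exact this _
  generalize tableBracket (heisenbergRels m) y z = w at key
  unfold heisenbergRels
  induction List.finRange m with
  | nil => rfl
  | cons i l ih =>
    rw [List.map_cons, tableBracket_cons, ih, key, key]
    · simp
    · simp [Fin.ext_iff]; omega
    · simp [Fin.ext_iff]; omega

/-- `H(m)`, the Heisenberg Lie algebra of dimension `2m + 1`. -/
abbrev H (F : Type*) [Field F] (m : ℕ) : Type _ :=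
  BracketTable.Alg (F := F) (n := 2 * m + 1) ⟨heisenbergRels m, fun x y z => by
    rw [heisenberg_bracket_bracket, heisenberg_bracket_bracket, tableBracket_swap,
      heisenberg_bracket_bracket, neg_zero, add_zero]⟩

/-- `L_{4,3}`: `[x₁,x₂] = x₃`, `[x₁,x₃] = x₄` (indices below start at `0`). -/
abbrev L43 (F : Type*) [Field F] : Type _ :=
  BracketTable.Alg (F := F) (n := 4) ⟨[(0, 1, 2), (0, 2, 3)], fun x y z => by
    funext i; fin_cases i <;> simp [tableBracket, Pi.single_apply] <;> ring⟩

/-- `L_{5,1} = A(5)`. -/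
abbrev L51 (F : Type*) [Field F] : Type _ := A F 5

/-- `L_{5,2} = H(1) ⊕ A(2)`. -/
abbrev L52 (F : Type*) [Field F] : Type _ := H F 1 × A F 2

/-- `L_{5,3} = L_{4,3} ⊕ A(1)`. -/
abbrev L53 (F : Type*) [Field F] : Type _ := L43 F × A F 1

/-- `L_{5,4} = H(2)`. -/
abbrev L54 (F : Type*) [Field F] : Type _ := H F 2

/-- `L_{5,5}`: `[x₁,x₂] = x₃`, `[x₁,x₃] = [x₂,x₄] = x₅`. -/
abbrev L55 (F : Type*) [Field F] : Type _ :=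
  BracketTable.Alg (F := F) (n := 5) ⟨[(0, 1, 2), (0, 2, 4), (1, 3, 4)], fun x y z => by
    funext i; fin_cases i <;> simp [tableBracket, Pi.single_apply] <;> ring⟩

/-- `L_{5,6}`: `[x₁,x₂] = x₃`, `[x₁,x₃] = x₄`, `[x₁,x₄] = [x₂,x₃] = x₅`. -/
abbrev L56 (F : Type*) [Field F] : Type _ :=
  BracketTable.Alg (F := F) (n := 5)
    ⟨[(0, 1, 2), (0, 2, 3), (0, 3, 4), (1, 2, 4)], fun x y z => by
      funext i; fin_cases i <;> simp [tableBracket, Pi.single_apply] <;> ring⟩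

/-- `L_{5,7}`: `[x₁,x₂] = x₃`, `[x₁,x₃] = x₄`, `[x₁,x₄] = x₅`. -/
abbrev L57 (F : Type*) [Field F] : Type _ :=
  BracketTable.Alg (F := F) (n := 5) ⟨[(0, 1, 2), (0, 2, 3), (0, 3, 4)], fun x y z => by
    funext i; fin_cases i <;> simp [tableBracket, Pi.single_apply] <;> ring⟩

/-- `L_{5,8}`: `[x₁,x₂] = x₄`, `[x₁,x₃] = x₅`. -/
abbrev L58 (F : Type*) [Field F] : Type _ :=
  BracketTable.Alg (F := F) (n := 5) ⟨[(0, 1, 3), (0, 2, 4)], fun x y z => by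
    funext i; fin_cases i <;> simp [tableBracket, Pi.single_apply]⟩

/-- `L_{5,9}`: `[x₁,x₂] = x₃`, `[x₁,x₃] = x₄`, `[x₂,x₃] = x₅`. -/
abbrev L59 (F : Type*) [Field F] : Type _ :=
  BracketTable.Alg (F := F) (n := 5) ⟨[(0, 1, 2), (0, 2, 3), (1, 2, 4)], fun x y z => by
    funext i; fin_cases i <;> simp [tableBracket, Pi.single_apply] <;> ring⟩

/-! ### The nonabelian tensor square and its diagonal ideal -/

section TensorSquare

variable (F : Type*) [Field F] (L : Type*) [LieRing L] [LieAlgebra F L]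

/-- The free generator `l ⊗ k`, before the relations are imposed. -/
noncomputable def preTensor (l k : L) : FreeLieAlgebra F (L × L) := FreeLieAlgebra.of F (l, k)

/-- The defining relations of the nonabelian tensor product `L ⊗ K` of Lie algebras for `K = L`,
where `L` acts on itself by `ˡk = [l, k]`; each constructor says that (left side) - (right side)
is a relator. -/
inductive TensorRel : FreeLieAlgebra F (L × L) → Prop
  | smul_left (c : F) (l k : L) :
      TensorRel (c • preTensor F L l k - preTensor F L (c • l) k)
  | smul_right (c : F) (l k : L) :
      TensorRel (c • preTensor F L l k - preTensor F L l (c • k))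
  | add_left (l l' k : L) :
      TensorRel (preTensor F L (l + l') k - (preTensor F L l k + preTensor F L l' k))
  | add_right (l k k' : L) :
      TensorRel (preTensor F L l (k + k') - (preTensor F L l k + preTensor F L l k'))
  | lie_left (l l' k : L) :
      TensorRel (preTensor F L ⁅l, l'⁆ k - (preTensor F L l ⁅l', k⁆ - preTensor F L l' ⁅l, k⁆))
  | lie_right (l k k' : L) :
      TensorRel (preTensor F L l ⁅k, k'⁆ - (preTensor F L ⁅k', l⁆ k - preTensor F L ⁅k, l⁆ k'))
  | lie_lie (l k l' k' : L) :
      TensorRel (⁅preTensor F L l k, preTensor F L l' k'⁆ - -preTensor F L ⁅k, l⁆ ⁅l', k'⁆)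

/-- The nonabelian tensor square `L ⊗ L`: the Lie algebra generated by the symbols `l ⊗ k`
subject to the relations above. -/
abbrev TensorSquare : Type _ :=
  FreeLieAlgebra F (L × L) ⧸
    (LieSubmodule.lieSpan F (FreeLieAlgebra F (L × L)) {r | TensorRel F L r} :
      LieIdeal F (FreeLieAlgebra F (L × L)))

variable {L}

/-- The element `l ⊗ k` of the nonabelian tensor square. -/
noncomputable def tensor (l k : L) : TensorSquare F L := LieSubmodule.Quotient.mk (preTensor F L l k)

variable (L)

/-- The diagonal ideal `L □ L`: the ideal of `L ⊗ L` generated by the elements `l ⊗ l`. -/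
noncomputable def diagonalIdeal : LieIdeal F (TensorSquare F L) :=
  LieSubmodule.lieSpan F (TensorSquare F L) (Set.range fun l : L => tensor F l l)

/-- The derived subalgebra `L² = [L, L]`, as an ideal. -/
abbrev derivedIdeal : LieIdeal F L := ⁅(⊤ : LieIdeal F L), (⊤ : LieIdeal F L)⁆

end TensorSquare

end LieSquare

/-!
For every Lie algebra `L`, nilpotent or not and over a field of any characteristic, the diagonal
ideal `L □ L` is determined by `r = dim L / L²` when this is finite: it is abelian of dimension
`r (r + 1) / 2`.

Each `l ⊗ l` is central in `L ⊗ L` (`lie_tensor_self`), because its bracket with `x ⊗ y` is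
`-[y, x] ⊗ [l, l]`. So `L □ L` is abelian, and it is the linear span of the squares `l ⊗ l`.

The main point is that `l ⊗ l` depends only on `l` modulo `L²`. Let `⟨l, k⟩ = l ⊗ k + k ⊗ l`. By the
relation for `k ⊗ [k, k']` the trilinear map `⟨[a, b], c⟩` is alternating, hence invariant under
cyclic rotation, while the relations for `[a, b] ⊗ c` and `c ⊗ [a, b]` add up to
`⟨[a, b], c⟩ = ⟨[b, c], a⟩ + ⟨[c, a], b⟩`. The map therefore equals its own double and vanishes
(`polar_lie_eq_zero`). Moreover `[x, y] ⊗ [x, y] = [x ⊗ y, x ⊗ y] = 0`, so `w ⊗ w = 0` for all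
`w ∈ L²`, and `(l + w) ⊗ (l + w) = l ⊗ l`.

Hence, if the `e i` lift a basis of `L / L²`, the elements `e i ⊗ e i` and `⟨e i, e j⟩`, `i < j`, span
`L □ L` (`span_diagonalFamily`). They are independent, since a bilinear form on `L / L²` extends to a
linear form on `L ⊗ L` (`exists_linearMap_tensor`).

Abelian Lie algebras of equal finite dimension are isomorphic, so the isomorphism of `L □ L` with
`(L / L²) □ (L / L²)` is a comparison of dimensions, and for the algebras of dimension five it is
enough to read `dim L / L²` off the table of brackets (`IsAbelianization`).
-/

namespace LieSquare

open Module

/-! ### Bilinearity of the tensor symbols and polarisation -/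

section General

variable {F : Type*} [Field F] {L : Type*} [LieRing L] [LieAlgebra F L]

theorem mk_eq_mk_of_tensorRel {a b : FreeLieAlgebra F (L × L)} (h : TensorRel F L (a - b)) :
    (LieSubmodule.Quotient.mk a : TensorSquare F L) = LieSubmodule.Quotient.mk b :=
  (Submodule.Quotient.eq _).2 (LieSubmodule.subset_lieSpan h)

theorem tensor_add_left (l l' k : L) :
    tensor F (l + l') k = tensor F l k + tensor F l' k :=
  mk_eq_mk_of_tensorRel (.add_left l l' k)

theorem tensor_add_right (l k k' : L) :
    tensor F l (k + k') = tensor F l k + tensor F l k' :=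
  mk_eq_mk_of_tensorRel (.add_right l k k')

theorem tensor_smul_left (c : F) (l k : L) : tensor F (c • l) k = c • tensor F l k :=
  (mk_eq_mk_of_tensorRel (.smul_left c l k)).symm

theorem tensor_smul_right (c : F) (l k : L) : tensor F l (c • k) = c • tensor F l k :=
  (mk_eq_mk_of_tensorRel (.smul_right c l k)).symm

theorem tensor_lie_left (l l' k : L) :
    tensor F ⁅l, l'⁆ k = tensor F l ⁅l', k⁆ - tensor F l' ⁅l, k⁆ :=
  mk_eq_mk_of_tensorRel (.lie_left l l' k)

theorem tensor_lie_right (l k k' : L) :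
    tensor F l ⁅k, k'⁆ = tensor F ⁅k', l⁆ k - tensor F ⁅k, l⁆ k' :=
  mk_eq_mk_of_tensorRel (.lie_right l k k')

theorem lie_tensor_tensor (l k l' k' : L) :
    ⁅tensor F l k, tensor F l' k'⁆ = -tensor F ⁅k, l⁆ ⁅l', k'⁆ :=
  mk_eq_mk_of_tensorRel (.lie_lie l k l' k')

variable (F L) in
/-- The symbol `l ⊗ k` as a bilinear map. -/
noncomputable def tensorBilin : L →ₗ[F] L →ₗ[F] TensorSquare F L :=
  LinearMap.mk₂ F (tensor F) tensor_add_left tensor_smul_left tensor_add_right tensor_smul_right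

theorem tensorBilin_apply (l k : L) : tensorBilin F L l k = tensor F l k := rfl

variable (F L) in
/-- The symmetric bilinear map `(l, k) ↦ l ⊗ k + k ⊗ l`, the polarisation of `l ↦ l ⊗ l`. -/
noncomputable def polar : L →ₗ[F] L →ₗ[F] TensorSquare F L :=
  tensorBilin F L + (tensorBilin F L).flip

theorem polar_apply (l k : L) : polar F L l k = tensor F l k + tensor F k l := rfl

theorem polar_comm (l k : L) : polar F L l k = polar F L k l := by
  rw [polar_apply, polar_apply, add_comm]

theorem tensor_add_self (l k : L) :
    tensor F (l + k) (l + k) = tensor F l l + tensor F k k + polar F L l k := by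
  rw [tensor_add_left, tensor_add_right, tensor_add_right, polar_apply]
  abel

theorem tensor_smul_self (c : F) (l : L) :
    tensor F (c • l) (c • l) = (c * c) • tensor F l l := by
  rw [tensor_smul_left, tensor_smul_right, smul_smul]

/-! ### The derived subalgebra does not contribute to the diagonal -/

/-- The sum of the relations for `[a, b] ⊗ c` and for `c ⊗ [a, b]`. -/
theorem polar_lie_cyclic (a b c : L) :
    polar F L ⁅a, b⁆ c = polar F L ⁅b, c⁆ a + polar F L ⁅c, a⁆ b := by
  rw [← lie_skew c a, map_neg, LinearMap.neg_apply, polar_apply, polar_apply, polar_apply,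
    tensor_lie_left a b c, tensor_lie_right c a b]
  abel

/-- The relation for `k ⊗ [k, k']` has one vanishing term, so it says that the two symbols
anticommute. -/
theorem polar_lie_left_self (k k' : L) : polar F L ⁅k, k'⁆ k = 0 := by
  have h := tensor_lie_right (F := F) k k k'
  have h0 : tensor F (0 : L) k' = 0 := LinearMap.map_zero₂ (tensorBilin F L) k'
  rw [lie_self, h0, sub_zero, ← lie_skew k' k] at h
  rw [polar_apply, h, ← tensor_add_left, add_neg_cancel, ← tensorBilin_apply,
    LinearMap.map_zero₂]

/-- The trilinear map `(a, b, c) ↦ polar [a, b] c` is alternating, hence invariant under cyclic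
rotation; by `polar_lie_cyclic` it then equals its own double. This works in every
characteristic, including two. -/
theorem polar_lie_eq_zero (a b c : L) : polar F L ⁅a, b⁆ c = 0 := by
  have swap : ∀ x y z : L, polar F L ⁅x, y⁆ z = -polar F L ⁅z, y⁆ x := by
    intro x y z
    have h := polar_lie_left_self (F := F) (x + z) y
    simp only [add_lie, map_add, LinearMap.add_apply, polar_lie_left_self, zero_add,
      add_zero] at h
    exact eq_neg_of_add_eq_zero_right h
  have rot : ∀ x y z : L, polar F L ⁅x, y⁆ z = polar F L ⁅y, z⁆ x := by
    intro x y z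
    rw [swap, ← lie_skew y z, map_neg, LinearMap.neg_apply]
  have h := polar_lie_cyclic (F := F) a b c
  rw [rot a b c, rot b c a] at h
  rw [rot a b c, rot b c a]
  simpa using h

theorem derivedIdeal_induction {p : L → Prop} (lie : ∀ x y : L, p ⁅x, y⁆) (zero : p 0)
    (add : ∀ x ∈ derivedIdeal F L, ∀ y ∈ derivedIdeal F L, p x → p y → p (x + y))
    (smul : ∀ (c : F) (x : L), p x → p (c • x)) {w : L} (hw : w ∈ derivedIdeal F L) : p w := by
  rw [← LieSubmodule.mem_toSubmodule, LieSubmodule.lieIdeal_oper_eq_linear_span'] at hw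
  have key := LieSubmodule.lieIdeal_oper_eq_linear_span' (R := F) (⊤ : LieIdeal F L)
    (⊤ : LieIdeal F L)
  induction hw using Submodule.span_induction with
  | mem x hx =>
    obtain ⟨a, -, b, -, rfl⟩ := hx
    exact lie a b
  | zero => exact zero
  | add x y hx hy px py =>
    rw [← key] at hx hy
    exact add x hx y hy px py
  | smul c x _ px => exact smul c x px

theorem polar_eq_zero_of_mem_derivedIdeal {w : L} (hw : w ∈ derivedIdeal F L) (l : L) :
    polar F L w l = 0 := by
  refine derivedIdeal_induction (p := fun w => polar F L w l = 0)
    (fun x y => polar_lie_eq_zero x y l) (LinearMap.map_zero₂ _ _) (fun x _ y _ hx hy => ?_)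
    (fun c x hx => ?_) hw
  · rw [map_add, LinearMap.add_apply, hx, hy, add_zero]
  · rw [map_smul, LinearMap.smul_apply, hx, smul_zero]

theorem tensor_self_eq_zero_of_mem_derivedIdeal {w : L} (hw : w ∈ derivedIdeal F L) :
    tensor F w w = 0 := by
  refine derivedIdeal_induction (p := fun w => tensor F w w = 0) (fun x y => ?_) ?_
    (fun x hx y _ h h' => ?_) (fun c x h => ?_) hw
  · -- The relation for `[l ⊗ k, l' ⊗ k']` applied to the vanishing bracket `[x ⊗ y, x ⊗ y]`.
    have h := lie_tensor_tensor (F := F) x y x y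
    rwa [lie_self, ← lie_skew y x, ← tensorBilin_apply, map_neg, LinearMap.neg_apply, neg_neg,
      tensorBilin_apply, eq_comm] at h
  · rw [← tensorBilin_apply, map_zero]
  · rw [tensor_add_self, h, h', polar_eq_zero_of_mem_derivedIdeal hx, add_zero, add_zero]
  · rw [tensor_smul_self, h, smul_zero]

theorem tensor_self_add_of_mem_derivedIdeal (l : L) {w : L} (hw : w ∈ derivedIdeal F L) :
    tensor F (l + w) (l + w) = tensor F l l := by
  rw [tensor_add_self, tensor_self_eq_zero_of_mem_derivedIdeal hw, polar_comm,
    polar_eq_zero_of_mem_derivedIdeal hw, add_zero, add_zero]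

/-! ### The diagonal ideal is central and spanned by the squares -/

/-- A subalgebra of the free Lie algebra that contains the generators is everything: lifting the
generators into it gives a section of its inclusion. -/
theorem freeLieAlgebra_subalgebra_eq_top {X : Type*} (K : LieSubalgebra F (FreeLieAlgebra F X))
    (h : ∀ x, FreeLieAlgebra.of F x ∈ K) : K = ⊤ := by
  rw [eq_top_iff]
  intro a _
  have hid : K.incl.comp (FreeLieAlgebra.lift F fun x => (⟨_, h x⟩ : K)) = LieHom.id :=
    FreeLieAlgebra.hom_ext fun x => by simp [FreeLieAlgebra.lift_of_apply]
  have := LieHom.congr_fun hid a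
  rw [LieHom.comp_apply, LieHom.id_apply] at this
  rw [← this]
  exact SetLike.coe_mem _

/-- The bracket of `x ⊗ y` with `l ⊗ l` is `-[y, x] ⊗ [l, l] = 0`, so the elements that commute with
`l ⊗ l` form a subalgebra containing all generators. -/
theorem lie_tensor_self (t : TensorSquare F L) (l : L) : ⁅t, tensor F l l⁆ = 0 := by
  obtain ⟨a, rfl⟩ := LieSubmodule.Quotient.surjective_mk' _ t
  let K : LieSubalgebra F (FreeLieAlgebra F (L × L)) :=
    { carrier := {a | ⁅(LieSubmodule.Quotient.mk a : TensorSquare F L), tensor F l l⁆ = 0}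
      zero_mem' := zero_lie _
      add_mem' := fun {a b} ha hb => by
        have : (LieSubmodule.Quotient.mk (a + b) : TensorSquare F L) =
          LieSubmodule.Quotient.mk a + LieSubmodule.Quotient.mk b := rfl
        rw [Set.mem_ofPred_eq] at *
        rw [this, add_lie, ha, hb, add_zero]
      smul_mem' := fun c a ha => by
        have : (LieSubmodule.Quotient.mk (c • a) : TensorSquare F L) =
          c • LieSubmodule.Quotient.mk a := rfl
        rw [Set.mem_ofPred_eq] at *
        rw [this, smul_lie, ha, smul_zero]
      lie_mem' := fun {a b} ha hb => by
        change ⁅(LieSubmodule.Quotient.mk ⁅a, b⁆ : TensorSquare F L), tensor F l l⁆ = 0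
        change ⁅(LieSubmodule.Quotient.mk a : TensorSquare F L), tensor F l l⁆ = 0 at ha
        change ⁅(LieSubmodule.Quotient.mk b : TensorSquare F L), tensor F l l⁆ = 0 at hb
        rw [LieSubmodule.Quotient.mk_bracket, lie_lie, ha, hb, lie_zero, lie_zero, sub_zero] }
  have hK : K = ⊤ := freeLieAlgebra_subalgebra_eq_top K fun x => by
    change ⁅tensor F x.1 x.2, tensor F l l⁆ = 0
    rw [lie_tensor_tensor, lie_self, ← tensorBilin_apply, map_zero, neg_zero]
  exact (hK ▸ LieSubalgebra.mem_top a : a ∈ K)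

variable (F L) in
theorem diagonalIdeal_toSubmodule :
    (diagonalIdeal F L).toSubmodule = Submodule.span F (Set.range fun l : L => tensor F l l) := by
  refine le_antisymm ?_ LieSubmodule.submodule_span_le_lieSpan
  let N : LieIdeal F (TensorSquare F L) :=
    { Submodule.span F (Set.range fun l : L => tensor F l l) with
      lie_mem := fun {t s} hs => by
        suffices ⁅t, s⁆ = 0 by rw [this]; exact Submodule.zero_mem _
        induction hs using Submodule.span_induction with
        | mem s hs => obtain ⟨l, rfl⟩ := hs; exact lie_tensor_self t l
        | zero => exact lie_zero t
        | add x y _ _ hx hy => rw [lie_add, hx, hy, add_zero]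
        | smul c x _ hx => rw [lie_smul, hx, smul_zero] }
  have : diagonalIdeal F L ≤ N := LieSubmodule.lieSpan_le.2 Submodule.subset_span
  exact this

theorem lie_eq_zero_of_mem_diagonalIdeal (t : TensorSquare F L) {s : TensorSquare F L}
    (hs : s ∈ diagonalIdeal F L) : ⁅t, s⁆ = 0 := by
  rw [← LieSubmodule.mem_toSubmodule, diagonalIdeal_toSubmodule] at hs
  induction hs using Submodule.span_induction with
  | mem s hs => obtain ⟨l, rfl⟩ := hs; exact lie_tensor_self t l
  | zero => exact lie_zero t
  | add x y _ _ hx hy => rw [lie_add, hx, hy, add_zero]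
  | smul c x _ hx => rw [lie_smul, hx, smul_zero]

theorem tensor_self_mem_diagonalIdeal (l : L) : tensor F l l ∈ diagonalIdeal F L :=
  LieSubmodule.subset_lieSpan ⟨l, rfl⟩

theorem polar_mem_diagonalIdeal (l k : L) : polar F L l k ∈ diagonalIdeal F L := by
  have h : polar F L l k = tensor F (l + k) (l + k) - tensor F l l - tensor F k k := by
    rw [tensor_add_self]; abel
  rw [h]
  exact sub_mem (sub_mem (tensor_self_mem_diagonalIdeal _) (tensor_self_mem_diagonalIdeal _))
    (tensor_self_mem_diagonalIdeal _)

/-! ### Bilinear forms and the dimension of the diagonal ideal -/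

attribute [local instance 100] LieRing.ofAssociativeRing

/-- A bilinear map into a commutative algebra `B` that vanishes as soon as one argument is a
commutator extends to the nonabelian tensor square. -/
theorem exists_linearMap_tensor {B : Type*} [CommRing B] [Algebra F B] (β : L →ₗ[F] L →ₗ[F] B)
    (hl : ∀ a b c : L, β ⁅a, b⁆ c = 0) (hr : ∀ a b c : L, β c ⁅a, b⁆ = 0) :
    ∃ φ : TensorSquare F L →ₗ[F] B, ∀ l k, φ (tensor F l k) = β l k := by
  -- `B` is regarded as an abelian Lie algebra, through its commutator bracket.
  let Φ : FreeLieAlgebra F (L × L) →ₗ⁅F⁆ B := FreeLieAlgebra.lift F fun p => β p.1 p.2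
  have hΦ : ∀ l k, Φ (preTensor F L l k) = β l k := fun l k =>
    FreeLieAlgebra.lift_of_apply (R := F) (fun p : L × L => β p.1 p.2) (l, k)
  have hker : (LieSubmodule.lieSpan F (FreeLieAlgebra F (L × L)) {r | TensorRel F L r} :
      LieIdeal F (FreeLieAlgebra F (L × L))) ≤ Φ.ker := by
    refine LieSubmodule.lieSpan_le.2 ?_
    rintro r (⟨⟩ | ⟨⟩ | ⟨⟩ | ⟨⟩ | ⟨⟩ | ⟨⟩ | ⟨⟩) <;>
      simp [LieHom.mem_ker, hΦ, hl, hr, Ring.lie_def, mul_comm]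
  exact ⟨Submodule.liftQ _ (Φ : FreeLieAlgebra F (L × L) →ₗ[F] B) hker, hΦ⟩

/-- The squares `e i ⊗ e i` and the polarised products `e i ⊗ e j + e j ⊗ e i`, `i < j`, of a family
`e` in `L`, indexed by the pairs `i ≤ j`. For lifts `e` of a basis of `L / L²` this is a basis of
the diagonal ideal. -/
noncomputable def diagonalFamily {ι : Type*} [LinearOrder ι] (e : ι → L)
    (p : {p : ι × ι // p.1 ≤ p.2}) : TensorSquare F L :=
  if p.1.1 = p.1.2 then tensor F (e p.1.1) (e p.1.1) else polar F L (e p.1.1) (e p.1.2)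

theorem span_diagonalFamily {ι : Type*} [LinearOrder ι] (e : ι → L)
    (he : ∀ l : L, ∃ s ∈ Submodule.span F (Set.range e), ∃ w ∈ derivedIdeal F L, l = s + w) :
    Submodule.span F (Set.range (diagonalFamily (F := F) e)) =
      (diagonalIdeal F L).toSubmodule := by
  refine le_antisymm (Submodule.span_le.2 ?_) ?_
  · rintro _ ⟨p, rfl⟩
    rw [diagonalFamily]
    split_ifs
    · exact tensor_self_mem_diagonalIdeal _
    · exact polar_mem_diagonalIdeal _ _
  · set W := Submodule.span F (Set.range (diagonalFamily (F := F) e)) with hW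
    have hsq : ∀ i, tensor F (e i) (e i) ∈ W := fun i =>
      Submodule.subset_span ⟨⟨(i, i), le_rfl⟩, by simp [diagonalFamily]⟩
    have hlt : ∀ i j, i < j → polar F L (e i) (e j) ∈ W := fun i j hij =>
      Submodule.subset_span ⟨⟨(i, j), hij.le⟩, by simp [diagonalFamily, hij.ne]⟩
    have hpol : ∀ i j, polar F L (e i) (e j) ∈ W := by
      intro i j
      rcases lt_trichotomy i j with h | rfl | h
      · exact hlt i j h
      · exact add_mem (hsq i) (hsq i)
      · rw [polar_comm]; exact hlt j i h
    have hpol' : ∀ s ∈ Submodule.span F (Set.range e), ∀ t ∈ Submodule.span F (Set.range e),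
        polar F L s t ∈ W := by
      intro s hs t ht
      induction hs, ht using Submodule.span_induction₂ with
      | mem_mem s t hs ht =>
        obtain ⟨i, rfl⟩ := hs
        obtain ⟨j, rfl⟩ := ht
        exact hpol i j
      | zero_left => rw [LinearMap.map_zero₂]; exact zero_mem _
      | zero_right => rw [map_zero]; exact zero_mem _
      | add_left x y z _ _ _ h h' => rw [LinearMap.map_add₂]; exact add_mem h h'
      | add_right x y z _ _ _ h h' => rw [map_add]; exact add_mem h h'
      | smul_left c x y _ _ h => rw [LinearMap.map_smul₂]; exact Submodule.smul_mem _ _ h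
      | smul_right c x y _ _ h => rw [map_smul]; exact Submodule.smul_mem _ _ h
    have hsq' : ∀ s ∈ Submodule.span F (Set.range e), tensor F s s ∈ W := by
      intro s hs
      induction hs using Submodule.span_induction with
      | mem s hs => obtain ⟨i, rfl⟩ := hs; exact hsq i
      | zero => rw [← tensorBilin_apply, map_zero]; exact zero_mem _
      | add x y hx hy h h' =>
        rw [tensor_add_self]; exact add_mem (add_mem h h') (hpol' x hx y hy)
      | smul c x _ h => rw [tensor_smul_self]; exact Submodule.smul_mem _ _ h
    rw [diagonalIdeal_toSubmodule, Submodule.span_le]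
    rintro _ ⟨l, rfl⟩
    obtain ⟨s, hs, w, hw, rfl⟩ := he l
    change tensor F (s + w) (s + w) ∈ W
    rw [tensor_self_add_of_mem_derivedIdeal s hw]
    exact hsq' s hs

theorem mk_lie_eq_zero (a b : L) :
    (LieSubmodule.Quotient.mk' (derivedIdeal F L)) ⁅a, b⁆ = 0 :=
  (LieSubmodule.Quotient.mk_eq_zero _).2
    (LieSubmodule.lie_mem_lie (LieSubmodule.mem_top a) (LieSubmodule.mem_top b))

/-- For `i ≤ j`, the product of the `i`-th coordinate modulo `L²` of the first tensor factor and the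
`j`-th one of the second vanishes on every member of the family but the one of index `(i, j)`, where
it is `1`. -/
theorem linearIndependent_diagonalFamily {ι : Type*} [LinearOrder ι]
    (b : Basis ι F (L ⧸ derivedIdeal F L)) (e : ι → L)
    (he : ∀ i, LieSubmodule.Quotient.mk' (derivedIdeal F L) (e i) = b i) :
    LinearIndependent F (diagonalFamily (F := F) e) := by
  classical
  let π : L →ₗ[F] L ⧸ derivedIdeal F L :=
    (LieSubmodule.Quotient.mk' (derivedIdeal F L) : L →ₗ[F] L ⧸ derivedIdeal F L)
  have hπ : ∀ a c : L, π ⁅a, c⁆ = 0 := mk_lie_eq_zero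
  have hπe : ∀ i, π (e i) = b i := he
  have hβ : ∀ p : {p : ι × ι // p.1 ≤ p.2}, ∃ φ : TensorSquare F L →ₗ[F] F,
      ∀ l k, φ (tensor F l k) = b.coord p.1.1 (π l) * b.coord p.1.2 (π k) := fun p => by
    refine exists_linearMap_tensor ((LinearMap.mul F F).compl₁₂ (b.coord p.1.1 ∘ₗ π)
      (b.coord p.1.2 ∘ₗ π)) ?_ ?_ <;> intro x y z <;>
      simp [hπ]
  choose φ hφ using hβ
  refine LinearIndependent.of_comp (LinearMap.pi φ) ?_
  have : (LinearMap.pi φ) ∘ (diagonalFamily (F := F) e) = fun p => Pi.single p (1 : F) := by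
    funext ⟨⟨i, j⟩, hij⟩ ⟨⟨i', j'⟩, hij'⟩
    have h : ¬ (i = j') ∨ ¬ (j = i') ∨ (i = i' ∧ j = j') := by
      by_contra! h
      obtain ⟨rfl, rfl, h⟩ := h
      have : i = j := le_antisymm hij hij'
      exact h this this.symm
    simp only [Function.comp_apply, LinearMap.pi_apply, diagonalFamily, Pi.single_apply,
      Subtype.mk.injEq, Prod.mk.injEq] at hij hij' ⊢
    split_ifs <;> simp_all [polar_apply, Finsupp.single_apply] <;> grind
  rw [this]
  exact Pi.linearIndependent_single_one _ _

end General

section Dimension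

variable (F : Type*) [Field F] (L : Type*) [LieRing L] [LieAlgebra F L]

/-- The family `diagonalFamily` built on lifts of a basis of `L / L²` is a basis of `L □ L`, whose
indices correspond to the unordered pairs of indices of that basis. -/
theorem finiteDimensional_and_finrank_diagonalIdeal [FiniteDimensional F (L ⧸ derivedIdeal F L)] :
    FiniteDimensional F (diagonalIdeal F L) ∧
      finrank F (diagonalIdeal F L) =
        finrank F (L ⧸ derivedIdeal F L) * (finrank F (L ⧸ derivedIdeal F L) + 1) / 2 := by
  let b := finBasis F (L ⧸ derivedIdeal F L)
  choose e he using fun i =>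
    LieSubmodule.Quotient.surjective_mk' (derivedIdeal F L) (b i)
  have hspan : ∀ l : L, ∃ s ∈ Submodule.span F (Set.range e), ∃ w ∈ derivedIdeal F L,
      l = s + w := by
    intro l
    refine ⟨∑ i, b.repr (LieSubmodule.Quotient.mk' (derivedIdeal F L) l) i • e i,
      Submodule.sum_mem _ fun i _ => Submodule.smul_mem _ _ (Submodule.subset_span ⟨i, rfl⟩),
      _, ?_, (add_sub_cancel _ l).symm⟩
    rw [← LieSubmodule.Quotient.mk_eq_zero, map_sub, map_sum]
    simp only [map_smul, he]
    rw [b.sum_repr, sub_self]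
  have key := span_diagonalFamily e hspan
  have hfin : FiniteDimensional F (diagonalIdeal F L).toSubmodule := by
    rw [← key]
    exact FiniteDimensional.span_of_finite F (Set.finite_range _)
  refine ⟨hfin, ?_⟩
  change finrank F (diagonalIdeal F L).toSubmodule = _
  rw [← key, finrank_span_eq_card (linearIndependent_diagonalFamily b e he),
    ← Fintype.card_congr Sym2.sortEquiv, Sym2.card, Fintype.card_fin, Nat.choose_two_right,
    Nat.add_sub_cancel, mul_comm]

variable {F L}

theorem lie_eq_zero_in_diagonalIdeal (x y : diagonalIdeal F L) : ⁅x, y⁆ = 0 :=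
  Subtype.ext (lie_eq_zero_of_mem_diagonalIdeal (x : TensorSquare F L) y.2)

theorem nonempty_lieEquiv_of_finrank_eq {M N : Type*} [LieRing M] [LieAlgebra F M] [LieRing N]
    [LieAlgebra F N] [FiniteDimensional F M] [FiniteDimensional F N]
    (hM : ∀ x y : M, ⁅x, y⁆ = 0) (hN : ∀ x y : N, ⁅x, y⁆ = 0)
    (h : finrank F M = finrank F N) : Nonempty (M ≃ₗ⁅F⁆ N) :=
  ⟨{ LinearEquiv.ofFinrankEq M N h with map_lie' := fun {x y} => by simp [hM, hN] }⟩

/-! ### Algebras given by a table of brackets -/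

instance {n : ℕ} (T : BracketTable F n) : FiniteDimensional F T.Alg :=
  inferInstanceAs (FiniteDimensional F (Fin n → F))

theorem finrank_alg {n : ℕ} (T : BracketTable F n) : finrank F T.Alg = n :=
  Module.finrank_fin_fun F

theorem lie_mem_derivedIdeal (x y : L) : ⁅x, y⁆ ∈ derivedIdeal F L :=
  LieSubmodule.lie_mem_lie (LieSubmodule.mem_top x) (LieSubmodule.mem_top y)

/-- A surjection `f` with kernel `L²` identifies its target with `L / L²`, whose dimension
determines the diagonal ideal. -/
theorem nonempty_diagonalIdeal_lieEquiv_A {V : Type*} [AddCommGroup V] [Module F V]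
    [FiniteDimensional F V] {N : ℕ} (f : L →ₗ[F] V) (hf : Function.Surjective f)
    (hlie : ∀ x y : L, f ⁅x, y⁆ = 0) (hker : ∀ x, f x = 0 → x ∈ derivedIdeal F L)
    (hN : finrank F V * (finrank F V + 1) / 2 = N) :
    Nonempty (diagonalIdeal F L ≃ₗ⁅F⁆ A F N) := by
  have hk : (derivedIdeal F L).toSubmodule = LinearMap.ker f := by
    refine le_antisymm (fun w hw => ?_) hker
    exact derivedIdeal_induction (p := fun w => f w = 0) hlie (map_zero f)
      (fun x _ y _ hx hy => by rw [map_add, hx, hy, add_zero])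
      (fun c x hx => by rw [map_smul, hx, smul_zero]) hw
  let E : (L ⧸ derivedIdeal F L) ≃ₗ[F] V :=
    (Submodule.quotEquivOfEq _ _ hk).trans (f.quotKerEquivOfSurjective hf)
  have : FiniteDimensional F (L ⧸ derivedIdeal F L) := E.symm.finiteDimensional
  obtain ⟨hfin, hrank⟩ := finiteDimensional_and_finrank_diagonalIdeal F L
  rw [E.finrank_eq, hN] at hrank
  exact nonempty_lieEquiv_of_finrank_eq lie_eq_zero_in_diagonalIdeal (fun _ _ => rfl)
    (hrank.trans (finrank_alg _).symm)

theorem tableBracket_apply_eq_zero {n : ℕ} {rels : List (Fin n × Fin n × Fin n)} {k : Fin n}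
    (h : ∀ q ∈ rels, k ≠ q.2.2) (x y : Fin n → F) : tableBracket rels x y k = 0 := by
  induction rels with
  | nil => rfl
  | cons q l ih =>
    rw [tableBracket_cons, Pi.add_apply, ih fun q hq => h q (List.mem_cons_of_mem _ hq),
      Pi.single_eq_of_ne (h q List.mem_cons_self), add_zero]

/-- If `(i, j, k)` is the only relation that involves the pair `{i, j}`, then `[x_i, x_j] = x_k`. -/
theorem tableBracket_single_single {n : ℕ} {rels : List (Fin n × Fin n × Fin n)} {i j k : Fin n}
    (hij : i ≠ j)
    (h : rels.filter (fun q => (q.1 = i ∧ q.2.1 = j) ∨ (q.1 = j ∧ q.2.1 = i)) = [(i, j, k)]) :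
    tableBracket rels (Pi.single i (1 : F)) (Pi.single j 1) = Pi.single k 1 := by
  have key : tableBracket rels (Pi.single i (1 : F)) (Pi.single j 1) = tableBracket
      (rels.filter (fun q => (q.1 = i ∧ q.2.1 = j) ∨ (q.1 = j ∧ q.2.1 = i)))
      (Pi.single i (1 : F)) (Pi.single j 1) := by
    clear h
    induction rels with
    | nil => rfl
    | cons q l ih =>
      rw [List.filter_cons]
      split_ifs with hq
      · rw [tableBracket_cons, tableBracket_cons, ih]
      · rw [tableBracket_cons, ih, add_eq_right]
        simp only [Pi.single_apply]
        convert Pi.single_zero q.2.2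
        grind
  rw [key, h, tableBracket_cons, tableBracket_nil, add_zero]
  simp [hij]

/-- The combinatorial condition on a table under which the coordinates in `c` present `L / L²`:
`c` is injective, no relation produces a basis vector in its range, and every other basis vector
`x_k` comes from a relation `[x_i, x_j] = x_k` that is the only one to involve the pair `{i, j}`. -/
def IsAbelianization {n r : ℕ} (rels : List (Fin n × Fin n × Fin n)) (c : Fin r → Fin n) : Prop :=
  (∀ a b, c a = c b → a = b) ∧ (∀ i, ∀ q ∈ rels, c i ≠ q.2.2) ∧
    ∀ k, (∃ a, c a = k) ∨ ∃ i j, i ≠ j ∧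
      rels.filter (fun q => (q.1 = i ∧ q.2.1 = j) ∨ (q.1 = j ∧ q.2.1 = i)) = [(i, j, k)]

set_option synthInstance.maxSize 1000 in
set_option synthInstance.maxHeartbeats 200000 in
instance {n r : ℕ} (rels : List (Fin n × Fin n × Fin n)) (c : Fin r → Fin n) :
    Decidable (IsAbelianization rels c) := by
  unfold IsAbelianization
  infer_instance

theorem exists_surjective_ker_eq_derivedIdeal {n r : ℕ} {T : BracketTable F n} (c : Fin r → Fin n)
    (hc : IsAbelianization T.rels c) :
    ∃ f : T.Alg →ₗ[F] (Fin r → F), Function.Surjective f ∧ (∀ x y : T.Alg, f ⁅x, y⁆ = 0) ∧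
      ∀ x, f x = 0 → x ∈ derivedIdeal F T.Alg := by
  obtain ⟨hinj, hlie, hker⟩ := hc
  refine ⟨(LinearMap.funLeft F F c : (Fin n → F) →ₗ[F] _),
    LinearMap.funLeft_surjective_of_injective F F c hinj,
    fun x y => funext fun i => tableBracket_apply_eq_zero (hlie i) _ _, fun x hx => ?_⟩
  have hsum : x = ∑ k, x k • (Pi.single k (1 : F) : Fin n → F) :=
    pi_eq_sum_univ' (R := F) x
  rw [hsum]
  refine (derivedIdeal F T.Alg).toSubmodule.sum_mem fun k _ => ?_
  rcases hker k with ⟨a, rfl⟩ | ⟨i, j, hij, h⟩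
  · have hxa : x (c a) = 0 := congrFun hx a
    rw [hxa, zero_smul]
    exact zero_mem (derivedIdeal F T.Alg)
  · rw [← tableBracket_single_single hij h]
    exact (derivedIdeal F T.Alg).smul_mem _ (lie_mem_derivedIdeal (F := F) (L := T.Alg) _ _)

theorem nonempty_diagonalIdeal_alg_lieEquiv_A {n r N : ℕ} {T : BracketTable F n} (c : Fin r → Fin n)
    (hc : IsAbelianization T.rels c) (hN : r * (r + 1) / 2 = N) :
    Nonempty (diagonalIdeal F T.Alg ≃ₗ⁅F⁆ A F N) := by
  obtain ⟨f, hf, hfl, hfk⟩ := exists_surjective_ker_eq_derivedIdeal c hc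
  exact nonempty_diagonalIdeal_lieEquiv_A f hf hfl hfk (by rwa [Module.finrank_fin_fun])

/-- An abelian summand `A(s)` adds `s` dimensions to `L / L²` and nothing to `L²`. -/
theorem nonempty_diagonalIdeal_alg_prod_lieEquiv_A {n r N : ℕ} (s : ℕ) {T : BracketTable F n}
    (c : Fin r → Fin n) (hc : IsAbelianization T.rels c)
    (hN : (r + s) * (r + s + 1) / 2 = N) :
    Nonempty (diagonalIdeal F (T.Alg × A F s) ≃ₗ⁅F⁆ A F N) := by
  obtain ⟨f, hf, hfl, hfk⟩ := exists_surjective_ker_eq_derivedIdeal c hc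
  refine nonempty_diagonalIdeal_lieEquiv_A (f.prodMap (LinearMap.id : A F s →ₗ[F] A F s))
    (hf.prodMap Function.surjective_id) (fun x y => Prod.ext (hfl _ _) rfl) ?_
    (by rwa [Module.finrank_prod, Module.finrank_fin_fun, finrank_alg])
  rintro ⟨x, y⟩ hxy
  obtain ⟨hx, hy⟩ := Prod.ext_iff.1 hxy
  have hy' : y = 0 := hy
  rw [hy']
  refine derivedIdeal_induction (p := fun x : T.Alg => (x, (0 : A F s)) ∈ derivedIdeal F _)
    (fun a b => ?_) (zero_mem _) (fun a _ b _ ha hb => ?_) (fun d a ha => ?_) (hfk x hx)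
  · exact lie_mem_derivedIdeal ((a, 0) : T.Alg × A F s) (b, 0)
  · simpa using add_mem ha hb
  · simpa using (derivedIdeal F (T.Alg × A F s)).smul_mem d ha

/-! ### The abelianisation of the abelianisation -/

theorem finrank_quotient_derivedIdeal_quotient :
    finrank F ((L ⧸ derivedIdeal F L) ⧸ derivedIdeal F (L ⧸ derivedIdeal F L)) =
      finrank F (L ⧸ derivedIdeal F L) := by
  have h : (derivedIdeal F (L ⧸ derivedIdeal F L)).toSubmodule = ⊥ := by
    rw [eq_bot_iff]
    intro w hw
    refine derivedIdeal_induction (p := fun w : L ⧸ derivedIdeal F L => w = 0) (fun x y => ?_) rfl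
      (fun x _ y _ hx hy => by rw [hx, hy, add_zero])
      (fun c x hx => by rw [hx, smul_zero]) hw
    obtain ⟨a, rfl⟩ := LieSubmodule.Quotient.surjective_mk' _ x
    obtain ⟨b, rfl⟩ := LieSubmodule.Quotient.surjective_mk' _ y
    exact mk_lie_eq_zero a b
  exact (Submodule.quotEquivOfEqBot _ h).finrank_eq

end Dimension

end LieSquare

set_option maxRecDepth 10000 in
theorem lemma2p9 (F : Type*) [Field F] :
    (Nonempty (LieSquare.diagonalIdeal F (LieSquare.L51 F) ≃ₗ⁅F⁆ LieSquare.A F 15) ∧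
      Nonempty (LieSquare.diagonalIdeal F (LieSquare.L52 F) ≃ₗ⁅F⁆ LieSquare.A F 10) ∧
      Nonempty (LieSquare.diagonalIdeal F (LieSquare.L53 F) ≃ₗ⁅F⁆ LieSquare.A F 6) ∧
      Nonempty (LieSquare.diagonalIdeal F (LieSquare.L54 F) ≃ₗ⁅F⁆ LieSquare.A F 10) ∧
      Nonempty (LieSquare.diagonalIdeal F (LieSquare.L55 F) ≃ₗ⁅F⁆ LieSquare.A F 6) ∧
      Nonempty (LieSquare.diagonalIdeal F (LieSquare.L56 F) ≃ₗ⁅F⁆ LieSquare.A F 3) ∧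
      Nonempty (LieSquare.diagonalIdeal F (LieSquare.L57 F) ≃ₗ⁅F⁆ LieSquare.A F 3) ∧
      Nonempty (LieSquare.diagonalIdeal F (LieSquare.L58 F) ≃ₗ⁅F⁆ LieSquare.A F 6) ∧
      Nonempty (LieSquare.diagonalIdeal F (LieSquare.L59 F) ≃ₗ⁅F⁆ LieSquare.A F 3)) ∧
    ∀ (L : Type*) [LieRing L] [LieAlgebra F L] [FiniteDimensional F L] [LieRing.IsNilpotent L]
      (n m : ℕ), Module.finrank F L = n →
      Module.finrank F (LieSquare.derivedIdeal F L) = m →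
      Nonempty (LieSquare.diagonalIdeal F L ≃ₗ⁅F⁆
        LieSquare.diagonalIdeal F (L ⧸ LieSquare.derivedIdeal F L)) ∧
      FiniteDimensional F (LieSquare.diagonalIdeal F (L ⧸ LieSquare.derivedIdeal F L)) ∧
      Module.finrank F (LieSquare.diagonalIdeal F (L ⧸ LieSquare.derivedIdeal F L)) =
        (n - m) * (n - m + 1) / 2 := by
  refine ⟨⟨?_, ?_, ?_, ?_, ?_, ?_, ?_, ?_, ?_⟩, ?_⟩
  -- In each case the coordinates listed are those of generators: a complement of `L²`.
  · exact LieSquare.nonempty_diagonalIdeal_alg_lieEquiv_A ![0, 1, 2, 3, 4]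
      (by dsimp only; decide) rfl
  · exact LieSquare.nonempty_diagonalIdeal_alg_prod_lieEquiv_A 2 ![0, 1]
      (by dsimp only; decide) rfl
  · exact LieSquare.nonempty_diagonalIdeal_alg_prod_lieEquiv_A 1 ![0, 1]
      (by dsimp only; decide) rfl
  · exact LieSquare.nonempty_diagonalIdeal_alg_lieEquiv_A ![0, 1, 2, 3]
      (by dsimp only; decide) rfl
  · exact LieSquare.nonempty_diagonalIdeal_alg_lieEquiv_A ![0, 1, 3]
      (by dsimp only; decide) rfl
  · exact LieSquare.nonempty_diagonalIdeal_alg_lieEquiv_A ![0, 1]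
      (by dsimp only; decide) rfl
  · exact LieSquare.nonempty_diagonalIdeal_alg_lieEquiv_A ![0, 1]
      (by dsimp only; decide) rfl
  · exact LieSquare.nonempty_diagonalIdeal_alg_lieEquiv_A ![0, 1, 2]
      (by dsimp only; decide) rfl
  · exact LieSquare.nonempty_diagonalIdeal_alg_lieEquiv_A ![0, 1]
      (by dsimp only; decide) rfl
  · intro L _ _ _ _ n m hn hm
    have hr : Module.finrank F (L ⧸ LieSquare.derivedIdeal F L) = n - m := by
      have h := (LieSquare.derivedIdeal F L).toSubmodule.finrank_quotient_add_finrank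
      rw [hn] at h
      exact Nat.eq_sub_of_add_eq (hm ▸ h)
    have hfin : FiniteDimensional F (L ⧸ LieSquare.derivedIdeal F L) :=
      inferInstanceAs (FiniteDimensional F (L ⧸ (LieSquare.derivedIdeal F L).toSubmodule))
    have hfin' : FiniteDimensional F ((L ⧸ LieSquare.derivedIdeal F L) ⧸
        LieSquare.derivedIdeal F (L ⧸ LieSquare.derivedIdeal F L)) :=
      inferInstanceAs (FiniteDimensional F ((L ⧸ LieSquare.derivedIdeal F L) ⧸
        (LieSquare.derivedIdeal F (L ⧸ LieSquare.derivedIdeal F L)).toSubmodule))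
    obtain ⟨h₁, h₂⟩ := LieSquare.finiteDimensional_and_finrank_diagonalIdeal F L
    obtain ⟨h₃, h₄⟩ := LieSquare.finiteDimensional_and_finrank_diagonalIdeal F
      (L ⧸ LieSquare.derivedIdeal F L)
    rw [LieSquare.finrank_quotient_derivedIdeal_quotient] at h₄
    refine ⟨LieSquare.nonempty_lieEquiv_of_finrank_eq LieSquare.lie_eq_zero_in_diagonalIdeal
      LieSquare.lie_eq_zero_in_diagonalIdeal (h₂.trans h₄.symm), h₃, ?_⟩
    rw [h₄, hr]
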